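/- Let $X$ be a countably infinite set and let $(b,c)$ be a connected graph over $X$: $b\colon X\times X\to[0,\infty)$ is symmetric with zero diagonal and $\sum_{y} b(x,y)<\infty$ for all $x\in X$, $c\colon X\to[0,\infty)$ is arbitrary, and any two vertices are joined by a path along edges with $b>0$. For $f\colon X\to\mathbb R$ put $$\widetilde Q(f)=\tfrac12\sum_{x,y\in X} b(x,y)|f(x)-f(y)|^2+\sum_{x\in X}c(x)|f(x)|^2,\qquad \widetilde D=\{f:\widetilde Q(f)<\infty\}.$$ Fix $o\in X$, let $\|f\|_o=(\widetilde Q(f)+|f(o)|^2)^{1/2}$, and let $\widetilde D_0$ be the closure in $\widetilde D$, with respect to $\|\cdot\|_o$, of the finitely supported functions. Let $C_0(X)$ be the closure of the finitely supported functions with respect to the supremum norm, and assume that $(b,c)$ is uniformly transient, i.e. $\widetilde D_0\subseteq C_0(X)$. Let $R$ be the Royden compactification of $(b,c)$, that is, the (up to homeomorphism unique) compact Hausdorff space that contains $X$ as a dense open subset, to which each function in $\widetilde D\cap\ell^\infty(X)$ has a unique continuous extension, and whose points are separated by these extensions. Let the Royden algebra $\mathcal A$ be the closure of $\widetilde D\cap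 \ell^\infty(X)$ in $\ell^\infty(X)$, write $\hat f$ for the unique continuous extension of $f\in\mathcal A$ to $R$, and let $$\partial_hX=\{p\in R:\hat f(p)=0\text{ for all } f\in\widetilde D_0\cap\ell^\infty(X)\},\qquad C_0(\partial_hX)=\{\hat f|_{\partial_hX}: f\in\mathcal A\}.$$ For $f\colon X\to\mathbb R$ with $\sum_y b(x,y)|f(y)|<\infty$ for all $x\in X$ let $\mathcal Lf(x)=\sum_{y}b(x,y)(f(x)-f(y))+c(x)f(x)$. Then for every $\varphi\in C_0(\partial_hX)$ the Dirichlet problem $$\mathcal Lf=0\ \text{ on } X,\qquad \hat f|_{\partial_hX}=\varphi,$$ has a unique solution $f_\varphi\in\mathcal A$. Moreover, the map $C_0(\partial_hX)\to\mathcal A$, $\varphi\mapsto f_\varphi$, is an isometry with respect to the supremum norms. -/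

import Mathlib

open scoped ENNReal NNReal BoundedContinuousFunction

/-- A graph `(b, c)` over the vertex set `X`: a symmetric edge weight `b ≥ 0` with zero diagonal
and `∑ y, b x y < ∞` for every `x`, together with an arbitrary killing term `c ≥ 0`. -/
structure WeightedGraph (X : Type*) where
  /-- the edge weight -/
  b : X → X → ℝ≥0
  /-- the killing term -/
  c : X → ℝ≥0
  symm : ∀ x y, b x y = b y x
  diag : ∀ x, b x x = 0
  summable : ∀ x, Summable (b x)

namespace WeightedGraph

variable {X : Type*}

/-- The combinatorial graph: `x` and `y` are neighbors if and only if `b x y > 0`. -/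
def toSimpleGraph (G : WeightedGraph X) : SimpleGraph X where
  Adj x y := 0 < G.b x y
  symm := ⟨fun x y h => by rw [G.symm y x]; exact h⟩
  loopless := ⟨fun x h => by rw [G.diag x] at h; exact lt_irrefl _ h⟩

/-- Any two vertices are joined by a path of edges of positive weight. -/
def IsConnected (G : WeightedGraph X) : Prop := G.toSimpleGraph.Connected

/-- The generalized form
`Q f = 1/2 ∑_{x,y} b x y |f x - f y|² + ∑_x c x |f x|²`, with values in `[0, ∞]`. -/
noncomputable def energy (G : WeightedGraph X) (f : X → ℝ) : ℝ≥0∞ :=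
  2⁻¹ * (∑' x, ∑' y, (G.b x y : ℝ≥0∞) * ENNReal.ofReal (|f x - f y| ^ 2))
    + ∑' x, (G.c x : ℝ≥0∞) * ENNReal.ofReal (|f x| ^ 2)

/-- The generalized form domain: all functions of finite energy. -/
def finiteEnergy (G : WeightedGraph X) : Set (X → ℝ) := {f | G.energy f < ∞}

/-- The norm `‖f‖_o = (Q f + |f o|²)^{1/2}`, with values in `[0, ∞]`. -/
noncomputable def normAt (G : WeightedGraph X) (o : X) (f : X → ℝ) : ℝ≥0∞ :=
  (G.energy f + ENNReal.ofReal (|f o| ^ 2)) ^ (1 / 2 : ℝ)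

/-- The space `D₀`: the closure of the finitely supported functions in the space of functions
of finite energy with respect to `‖·‖_o`. -/
def finiteEnergyZero (G : WeightedGraph X) (o : X) : Set (X → ℝ) :=
  {f | f ∈ G.finiteEnergy ∧
    ∀ ε : ℝ≥0∞, 0 < ε → ∃ φ : X → ℝ, φ.support.Finite ∧ G.normAt o (f - φ) < ε}

/-- The space `C₀(X)`: the closure of the finitely supported functions with respect to the
supremum norm. -/
def vanishingAtInfinity (X : Type*) : Set (X → ℝ) :=
  {f | ∀ ε : ℝ, 0 < ε → ∃ φ : X → ℝ, φ.support.Finite ∧ ∀ x, |f x - φ x| ≤ ε}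

/-- Uniform transience of a (connected) graph: `D₀ ⊆ C₀(X)`. -/
def UniformlyTransient (G : WeightedGraph X) (o : X) : Prop :=
  G.finiteEnergyZero o ⊆ vanishingAtInfinity X

/-- The domain of the formal Laplacian. -/
def laplacianDomain (G : WeightedGraph X) : Set (X → ℝ) :=
  {f | ∀ x, Summable fun y => (G.b x y : ℝ) * |f y|}

/-- The formal Laplacian `L f x = ∑_y b x y (f x - f y) + c x f x`. -/
noncomputable def laplacian (G : WeightedGraph X) (f : X → ℝ) (x : X) : ℝ :=
  (∑' y, (G.b x y : ℝ) * (f x - f y)) + G.c x * f x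

/-- Harmonic functions: `f` lies in the domain of the formal Laplacian and `L f = 0` on `X`. -/
def IsHarmonic (G : WeightedGraph X) (f : X → ℝ) : Prop :=
  f ∈ G.laplacianDomain ∧ ∀ x, G.laplacian f x = 0

/-- The bounded functions of finite energy, `D ∩ ℓ^∞(X)`, as a subset of `ℓ^∞(X)`. -/
def boundedFiniteEnergy (G : WeightedGraph X) : Set (lp (fun _ : X => ℝ) ∞) :=
  {f | ⇑f ∈ G.finiteEnergy}

/-- The Royden algebra: the uniform closure of `D ∩ ℓ^∞(X)` in `ℓ^∞(X)`. -/
def roydenAlgebra (G : WeightedGraph X) : Set (lp (fun _ : X => ℝ) ∞) :=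
  closure G.boundedFiniteEnergy

/-- The compact Hausdorff space `R`, with the inclusion `ι : X → R`, is the Royden
compactification of the graph: `X` is a dense open subset of `R`, each bounded function of finite
energy has a unique continuous extension to `R`, and these extensions separate the points
of `R`. -/
structure IsRoydenCompactification (G : WeightedGraph X) {R : Type*} [TopologicalSpace R]
    (ι : X → R) : Prop where
  compact : CompactSpace R
  hausdorff : T2Space R
  injective : Function.Injective ι
  dense : DenseRange ι
  isOpen_range : IsOpen (Set.range ι)
  extends_uniquely : ∀ f ∈ G.boundedFiniteEnergy, ∃! F : C(R, ℝ), ∀ x, F (ι x) = f x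
  separates : ∀ p q : R, p ≠ q →
    ∃ f ∈ G.boundedFiniteEnergy, ∃ F : C(R, ℝ), (∀ x, F (ι x) = f x) ∧ F p ≠ F q

section Extension

variable {G : WeightedGraph X} {R : Type*} [TopologicalSpace R] {ι : X → R}

/-- Each function in the Royden algebra has a unique continuous extension to `R`. -/
theorem IsRoydenCompactification.existsUnique_extension (hR : G.IsRoydenCompactification ι)
    (f : G.roydenAlgebra) : ∃! F : C(R, ℝ), ∀ x, F (ι x) = f.1 x := by
  have := hR.compact
  have huniq : ∀ F F' : C(R, ℝ), (∀ x, F (ι x) = f.1 x) → (∀ x, F' (ι x) = f.1 x) → F = F' := by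
    intro F F' h h'
    refine DFunLike.coe_injective (hR.dense.equalizer F.continuous F'.continuous ?_)
    funext x
    simp [h, h']
  have hmem : ∀ F : C(R, ℝ), Memℓp (fun x => F (ι x)) ∞ := fun F =>
    memℓp_infty ⟨‖F‖, by rintro _ ⟨x, rfl⟩; exact F.norm_coe_le_norm (ι x)⟩
  let T : C(R, ℝ) → lp (fun _ : X => ℝ) ∞ := fun F => ⟨fun x => F (ι x), hmem F⟩
  have hT : Isometry T := by
    refine Isometry.of_dist_eq fun F F' => ?_
    rw [dist_eq_norm, dist_eq_norm]
    apply le_antisymm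
    · exact lp.norm_le_of_forall_le (norm_nonneg _) fun x => (F - F').norm_coe_le_norm (ι x)
    · refine (ContinuousMap.norm_le _ (norm_nonneg _)).2 fun p => ?_
      refine hR.dense.induction_on (p := fun p => ‖(F - F') p‖ ≤ ‖T F - T F'‖) p
        (isClosed_le (by fun_prop) continuous_const) fun x => ?_
      exact lp.norm_apply_le_norm ENNReal.top_ne_zero (T F - T F') x
  have hsub : G.roydenAlgebra ⊆ Set.range T := by
    refine closure_minimal ?_ hT.isClosedEmbedding.isClosed_range
    intro g hg
    obtain ⟨F, hF, -⟩ := hR.extends_uniquely g hg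
    exact ⟨F, by ext x; exact hF x⟩
  obtain ⟨F, hF⟩ := hsub f.2
  have hF' : ∀ x, F (ι x) = f.1 x := fun x => by rw [← hF]
  exact ⟨F, hF', fun F' h => huniq F' F h hF'⟩

/-- The unique continuous extension `\hat f` to `R` of a function `f` in the Royden algebra. -/
noncomputable def IsRoydenCompactification.hat (hR : G.IsRoydenCompactification ι)
    (f : G.roydenAlgebra) : C(R, ℝ) :=
  (hR.existsUnique_extension f).choose

theorem IsRoydenCompactification.hat_apply (hR : G.IsRoydenCompactification ι)
    (f : G.roydenAlgebra) (x : X) : hR.hat f (ι x) = f.1 x :=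
  (hR.existsUnique_extension f).choose_spec.1 x

/-- The harmonic boundary: all points of `R` at which the extensions of all functions in
`D₀ ∩ ℓ^∞(X)` vanish. -/
def IsRoydenCompactification.harmonicBoundary (hR : G.IsRoydenCompactification ι) (o : X) :
    Set R :=
  {p | ∀ (f : lp (fun _ : X => ℝ) ∞) (hf : ⇑f ∈ G.finiteEnergyZero o),
    hR.hat ⟨f, subset_closure hf.1⟩ p = 0}

/-- The restriction of `\hat f` to the harmonic boundary. -/
noncomputable def IsRoydenCompactification.trace (hR : G.IsRoydenCompactification ι) (o : X)
    (f : G.roydenAlgebra) : hR.harmonicBoundary o →ᵇ ℝ :=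
  haveI := hR.compact
  (BoundedContinuousFunction.mkOfCompact (hR.hat f)).domRestrict (hR.harmonicBoundary o)

/-- The space `C₀(∂_h X)` of the restrictions to the harmonic boundary of the extensions of the
functions in the Royden algebra; its distance is the one of uniform convergence. -/
def IsRoydenCompactification.boundaryFunctions (hR : G.IsRoydenCompactification ι) (o : X) :
    Set (hR.harmonicBoundary o →ᵇ ℝ) :=
  Set.range (hR.trace o)

/-- `f` in the Royden algebra solves the Dirichlet problem with boundary value `φ`:
`L f = 0` on `X` and `\hat f = φ` on the harmonic boundary. -/
def IsRoydenCompactification.SolvesDirichlet (hR : G.IsRoydenCompactification ι) (o : X)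
    (φ : hR.harmonicBoundary o →ᵇ ℝ) (f : G.roydenAlgebra) : Prop :=
  G.IsHarmonic f.1 ∧ ∀ p : hR.harmonicBoundary o, hR.hat f p = φ p

end Extension

section Existence

/-- The evaluation map of `X` into the product of lines indexed by `D ∩ ℓ^∞(X)`. -/
def evalMap (G : WeightedGraph X) (x : X) : G.boundedFiniteEnergy → ℝ := fun f => f.1 x

/-- A model of the Royden compactification: the closure of the image of the evaluation map. -/
abbrev RoydenSpace (G : WeightedGraph X) : Type _ := closure (Set.range G.evalMap)

/-- The inclusion of `X` into the model of the Royden compactification. -/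
def roydenIncl (G : WeightedGraph X) (x : X) : G.RoydenSpace :=
  ⟨G.evalMap x, subset_closure ⟨x, rfl⟩⟩

theorem energy_single_lt_top [DecidableEq X] (G : WeightedGraph X) (z : X) :
    G.energy (Pi.single z 1) < ∞ := by
  have hb : ∀ x, (∑' y, (G.b x y : ℝ≥0∞)) ≠ ∞ := fun x =>
    ENNReal.tsum_coe_ne_top_iff_summable.2 (G.summable x)
  have h1 : (∑' x, ∑' y, (G.b x y : ℝ≥0∞) *
      ENNReal.ofReal (|(Pi.single z 1 : X → ℝ) x - (Pi.single z 1 : X → ℝ) y| ^ 2)) ≤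
      (∑' y, (G.b z y : ℝ≥0∞)) + ∑' x, (G.b z x : ℝ≥0∞) := by
    calc _ ≤ ∑' x, ∑' y, ((if x = z then (G.b x y : ℝ≥0∞) else 0) +
            (if y = z then (G.b x y : ℝ≥0∞) else 0)) := by
          refine ENNReal.tsum_le_tsum fun x => ENNReal.tsum_le_tsum fun y => ?_
          by_cases hx : x = z <;> by_cases hy : y = z <;> simp [hx, hy]
      _ = _ := by
          simp_rw [ENNReal.tsum_add]
          congr 1
          · rw [tsum_eq_single z]
            · simp
            · intro x hx; simp [hx]
          · refine tsum_congr fun x => ?_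
            rw [tsum_eq_single z]
            · simp [G.symm x z]
            · intro y hy; simp [hy]
  have h2 : (∑' x, (G.c x : ℝ≥0∞) * ENNReal.ofReal (|(Pi.single z 1 : X → ℝ) x| ^ 2)) =
      G.c z := by
    rw [tsum_eq_single z]
    · simp
    · intro x hx; simp [hx]
  unfold energy
  rw [h2]
  refine ENNReal.add_lt_top.2 ⟨ENNReal.mul_lt_top (by simp) (h1.trans_lt ?_), by simp⟩
  exact ENNReal.add_lt_top.2 ⟨(hb z).lt_top, (hb z).lt_top⟩

/-- The Royden compactification exists. -/
theorem isRoydenCompactification_roydenIncl (G : WeightedGraph X) :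
    G.IsRoydenCompactification G.roydenIncl := by
  classical
  have hdense : DenseRange G.roydenIncl := by
    intro p
    rw [closure_subtype]
    have : (Subtype.val '' Set.range G.roydenIncl : Set (G.boundedFiniteEnergy → ℝ)) =
        Set.range G.evalMap := by
      rw [← Set.range_comp]; rfl
    rw [this]
    exact p.2
  let δ : X → G.boundedFiniteEnergy := fun z =>
    ⟨⟨Pi.single z 1, memℓp_infty ⟨1, by
      rintro _ ⟨x, rfl⟩
      by_cases h : x = z <;> simp [h]⟩⟩, G.energy_single_lt_top z⟩
  have hδ : ∀ z x, (G.roydenIncl x).1 (δ z) = if x = z then 1 else 0 := fun z x => by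
    simp [roydenIncl, evalMap, δ, Pi.single_apply]
  have hcoord : ∀ f : G.boundedFiniteEnergy, Continuous fun p : G.RoydenSpace => p.1 f :=
    fun f => (continuous_apply f).comp continuous_subtype_val
  have hT2 : T2Space G.RoydenSpace :=
    inferInstanceAs (T2Space (closure (Set.range G.evalMap)))
  have hext : ∀ f : G.boundedFiniteEnergy, ∃ F : C(G.RoydenSpace, ℝ),
      (∀ p, F p = p.1 f) ∧ ∀ x, F (G.roydenIncl x) = f.1 x :=
    fun f => ⟨⟨_, hcoord f⟩, fun _ => rfl, fun _ => rfl⟩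
  refine ⟨?_, hT2, ?_, hdense, ?_, ?_, ?_⟩
  · refine isCompact_iff_compactSpace.1 ?_
    refine (isCompact_univ_pi fun f : G.boundedFiniteEnergy =>
      isCompact_Icc (a := -‖f.1‖) (b := ‖f.1‖)).of_isClosed_subset isClosed_closure ?_
    refine closure_minimal ?_ (isClosed_set_pi fun _ _ => isClosed_Icc)
    rintro _ ⟨x, rfl⟩ f -
    exact abs_le.1 (lp.norm_apply_le_norm ENNReal.top_ne_zero f.1 x)
  · intro x y h
    have := hδ y x
    rw [h, hδ] at this
    by_contra hxy
    simp [hxy] at this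
  · rw [isOpen_iff_mem_nhds]
    rintro _ ⟨z, rfl⟩
    have hU : IsOpen {p : G.RoydenSpace | (1 / 2 : ℝ) < p.1 (δ z)} :=
      isOpen_lt continuous_const (hcoord _)
    refine Filter.mem_of_superset (hU.mem_nhds (by simp [hδ]; norm_num)) fun p hp => ?_
    have h1 := hdense.open_subset_closure_inter hU hp
    have h2 : {p : G.RoydenSpace | (1 / 2 : ℝ) < p.1 (δ z)} ∩ Set.range G.roydenIncl ⊆
        {G.roydenIncl z} := by
      rintro _ ⟨hq, ⟨x, rfl⟩⟩
      by_cases h : x = z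
      · rw [h]; rfl
      · simp [hδ, h] at hq
        norm_num at hq
    have h3 := closure_minimal h2 isClosed_singleton h1
    exact ⟨z, h3.symm⟩
  · intro f hf
    obtain ⟨F, -, hF⟩ := hext ⟨f, hf⟩
    refine ⟨F, hF, fun F' hF' => ?_⟩
    refine DFunLike.coe_injective (hdense.equalizer F'.continuous F.continuous ?_)
    funext x
    simp [hF, hF' x]
  · intro p q hpq
    have : ∃ f, p.1 f ≠ q.1 f := by
      by_contra! h
      exact hpq (Subtype.ext (funext h))
    obtain ⟨f, hf⟩ := this
    obtain ⟨F, hF, hF'⟩ := hext f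
    exact ⟨f.1, f.2, F, hF', by rwa [hF, hF]⟩

end Existence

end WeightedGraph

/-! The energy is the squared `ℓ²` norm of a weighted gradient, so existence is a Hilbert space
projection, while uniqueness and the isometry come from a maximum principle.

Existence: let `g` be bounded of finite energy. Its gradient is projected onto the closure of the
gradients of finitely supported functions. Since `X` is infinite, the constant 1 is not in `C₀(X)`,
so uniform transience keeps it out of `D₀`; hence `|φ o|` is bounded by a multiple of the gradient
norm for finitely supported `φ` (`UniformlyTransient.exists_bound`). The projection is therefore the
gradient of some `f ∈ D₀`. Green's formula against point masses makes `g - f` harmonic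
(`UniformlyTransient.exists_decomposition`). As `f ∈ C₀(X)` is bounded and its extension vanishes on
the harmonic boundary, `g - f` solves the problem with the boundary values of `g`.

Maximum principle: functions in `C₀(X)` vanish at every ideal point, so all of `R \ X` lies in the
harmonic boundary. The extension of a harmonic function attains its maximum on the compact space
`R`; a positive maximum at a vertex forces a constant by connectedness, and ideal points exist
because `X` is infinite. Applied to differences, this gives `SolvesDirichlet.dist_eq`: solutions are
exactly as far apart as their boundary values. Hence uniqueness, the isometry, and, by
approximation, existence for all of the Royden algebra. -/

open scoped ENNReal NNReal BoundedContinuousFunction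

namespace WeightedGraph

variable {X : Type*}

/-! ### Energy as a squared `ℓ²` norm -/

section Gradient

/-- The linear map whose squared `ℓ²`-norm is the energy. -/
noncomputable def gradient (G : WeightedGraph X) :
    (X → ℝ) →ₗ[ℝ] ((X × X) ⊕ X → ℝ) where
  toFun f := Sum.elim (fun q => √(G.b q.1 q.2 / 2) * (f q.1 - f q.2)) (fun x => √(G.c x) * f x)
  map_add' f g := by
    ext (q | x) <;> simp <;> ring
  map_smul' a f := by
    ext (q | x) <;> simp <;> ring

@[simp]
theorem gradient_inl (G : WeightedGraph X) (f : X → ℝ) (x y : X) :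
    G.gradient f (Sum.inl (x, y)) = √(G.b x y / 2) * (f x - f y) := rfl

@[simp]
theorem gradient_inr (G : WeightedGraph X) (f : X → ℝ) (x : X) :
    G.gradient f (Sum.inr x) = √(G.c x) * f x := rfl

/-- The sum over ordered pairs meets each edge twice; the weight `√(b / 2)` absorbs the factor 1/2
of the energy. -/
theorem tsum_sq_gradient (G : WeightedGraph X) (f : X → ℝ) :
    ∑' i, ENNReal.ofReal (G.gradient f i ^ 2) = G.energy f := by
  rw [Summable.tsum_sum ENNReal.summable ENNReal.summable, energy, ENNReal.tsum_prod',
    ← ENNReal.tsum_mul_left]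
  congr 1
  · refine tsum_congr fun x => ?_
    rw [← ENNReal.tsum_mul_left]
    refine tsum_congr fun y => ?_
    rw [gradient_inl, mul_pow, Real.sq_sqrt (by positivity), ENNReal.ofReal_mul (by positivity),
      sq_abs, ← mul_assoc, div_eq_inv_mul, ENNReal.ofReal_mul (by norm_num),
      ENNReal.ofReal_inv_of_pos (by norm_num)]
    simp
  · refine tsum_congr fun x => ?_
    rw [gradient_inr, mul_pow, Real.sq_sqrt (by positivity), ENNReal.ofReal_mul (by positivity),
      sq_abs]
    simp

theorem memℓp_gradient_iff (G : WeightedGraph X) {f : X → ℝ} :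
    Memℓp (G.gradient f) 2 ↔ f ∈ G.finiteEnergy := by
  rw [memℓp_gen_iff (by simp), finiteEnergy, Set.mem_ofPred_eq, ← tsum_sq_gradient]
  simp only [Real.norm_eq_abs, ENNReal.toReal_ofNat, Real.rpow_two, sq_abs]
  constructor
  · exact fun h => h.tsum_ofReal_lt_top
  · intro h
    refine (ENNReal.summable_toReal h.ne).congr fun i => ?_
    rw [ENNReal.toReal_ofReal (sq_nonneg _)]

/-- The space of functions of finite energy, as a submodule. -/
noncomputable def energySubmodule (G : WeightedGraph X) : Submodule ℝ (X → ℝ) where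
  carrier := G.finiteEnergy
  add_mem' {f g} hf hg := by
    rw [← memℓp_gradient_iff] at *
    rw [map_add]
    exact hf.add hg
  zero_mem' := by
    rw [← memℓp_gradient_iff, map_zero]
    exact zero_memℓp
  smul_mem' a f hf := by
    rw [← memℓp_gradient_iff] at *
    rw [map_smul]
    exact hf.const_smul a

/-- The gradient of a function of finite energy, as an element of `ℓ²`. -/
noncomputable def gradientLp (G : WeightedGraph X) :
    G.energySubmodule →ₗ[ℝ] lp (fun _ : (X × X) ⊕ X => ℝ) 2 where
  toFun f := ⟨G.gradient f, G.memℓp_gradient_iff.2 f.2⟩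
  map_add' f g := Subtype.ext (map_add G.gradient f.1 g.1)
  map_smul' a f := Subtype.ext (map_smul G.gradient a f.1)

@[simp]
theorem gradientLp_apply (G : WeightedGraph X) (f : G.energySubmodule) (i : (X × X) ⊕ X) :
    G.gradientLp f i = G.gradient f i := rfl

theorem energy_eq_norm_sq (G : WeightedGraph X) (f : G.energySubmodule) :
    G.energy f = ENNReal.ofReal (‖G.gradientLp f‖ ^ 2) := by
  have h := lp.hasSum_norm (p := 2) (by simp) (G.gradientLp f)
  simp only [ENNReal.toReal_ofNat, Real.rpow_two, Real.norm_eq_abs, sq_abs,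
    gradientLp_apply] at h
  rw [← tsum_sq_gradient, ← h.tsum_eq, ENNReal.ofReal_tsum_of_nonneg (fun _ => sq_nonneg _)
    h.summable]

theorem single_mem_finiteEnergy [DecidableEq X] (G : WeightedGraph X) (z : X) (a : ℝ) :
    Pi.single z a ∈ G.energySubmodule := by
  have h : (Pi.single z a : X → ℝ) = a • Pi.single z (1 : ℝ) := by
    ext x; simp [Pi.single_apply]
  rw [h]
  exact G.energySubmodule.smul_mem a (G.energy_single_lt_top z)

theorem finsupp_mem_finiteEnergy (G : WeightedGraph X) (φ : X →₀ ℝ) :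
    ⇑φ ∈ G.energySubmodule := by
  classical
  induction φ using Finsupp.induction_linear with
  | zero => exact G.energySubmodule.zero_mem
  | add f g hf hg => rw [Finsupp.coe_add]; exact G.energySubmodule.add_mem hf hg
  | single z a => rw [Finsupp.single_eq_pi_single]; exact G.single_mem_finiteEnergy z a

/-- The inclusion of the finitely supported functions into the functions of finite energy. -/
noncomputable def finsuppIncl (G : WeightedGraph X) : (X →₀ ℝ) →ₗ[ℝ] G.energySubmodule where
  toFun φ := ⟨φ, G.finsupp_mem_finiteEnergy φ⟩
  map_add' _ _ := rfl
  map_smul' _ _ := rfl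

@[simp]
theorem coe_finsuppIncl (G : WeightedGraph X) (φ : X →₀ ℝ) : (G.finsuppIncl φ).1 = φ := rfl

theorem normAt_coe (G : WeightedGraph X) (o : X) (f : G.energySubmodule) :
    G.normAt o f = (ENNReal.ofReal (‖G.gradientLp f‖ ^ 2 + |f.1 o| ^ 2)) ^ (1 / 2 : ℝ) := by
  rw [normAt, energy_eq_norm_sq, ENNReal.ofReal_add (by positivity) (by positivity)]

/-- Sequential criterion for membership in `D₀`. -/
theorem mem_finiteEnergyZero_of_tendsto (G : WeightedGraph X) (o : X) (f : G.energySubmodule)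
    (u : ℕ → X →₀ ℝ)
    (h1 : Filter.Tendsto (fun n => G.gradientLp (G.finsuppIncl (u n))) Filter.atTop
      (nhds (G.gradientLp f)))
    (h2 : Filter.Tendsto (fun n => u n o) Filter.atTop (nhds (f.1 o))) :
    f.1 ∈ G.finiteEnergyZero o := by
  refine ⟨f.2, fun ε hε => ?_⟩
  have h : Filter.Tendsto (fun n => G.normAt o (f - G.finsuppIncl (u n) : G.energySubmodule))
      Filter.atTop (nhds 0) := by
    simp_rw [normAt_coe, map_sub]
    have h3 := (((tendsto_const_nhds (x := G.gradientLp f)).sub h1).norm.pow 2).add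
      (((tendsto_const_nhds (x := f.1 o)).sub h2).abs.pow 2)
    have h4 := (ENNReal.tendsto_ofReal h3).ennrpow_const (1 / 2 : ℝ)
    simpa using h4
  obtain ⟨n, hn⟩ := (h.eventually (gt_mem_nhds hε)).exists
  exact ⟨u n, (u n).hasFiniteSupport, hn⟩

end Gradient

/-! ### Green's formula -/

section Laplacian

theorem summable_b_real (G : WeightedGraph X) (x : X) : Summable fun y => (G.b x y : ℝ) :=
  NNReal.summable_coe.2 (G.summable x)

/-- By `|t| ≤ 1 + t²`, summability of `b x ·` and finiteness of the energy on the edges at `x`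
suffice; no boundedness of `f` is needed. -/
theorem summable_b_mul_sub (G : WeightedGraph X) (f : G.energySubmodule) (x : X) :
    Summable fun y => (G.b x y : ℝ) * (f.1 x - f.1 y) := by
  have h := (memℓp_gen_iff (by simp)).1 (G.memℓp_gradient_iff.2 f.2)
  simp only [Real.norm_eq_abs, ENNReal.toReal_ofNat, Real.rpow_two, sq_abs] at h
  have hinj : Function.Injective fun y => (Sum.inl (x, y) : (X × X) ⊕ X) := by
    intro y z hyz
    simpa using hyz
  have h2 : Summable fun y => (G.b x y : ℝ) * (f.1 x - f.1 y) ^ 2 := by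
    refine ((h.comp_injective hinj).mul_left 2).congr fun y => ?_
    simp only [Function.comp_apply, gradient_inl, mul_pow]
    rw [Real.sq_sqrt (by positivity)]
    ring
  refine ((G.summable_b_real x).add h2).of_norm_bounded fun y => ?_
  rw [norm_mul, Real.norm_eq_abs, Real.norm_eq_abs, NNReal.abs_eq]
  have hb : (0 : ℝ) ≤ G.b x y := NNReal.coe_nonneg _
  have h3 : |f.1 x - f.1 y| ≤ 1 + (f.1 x - f.1 y) ^ 2 := by
    rw [← sq_abs]
    nlinarith [sq_nonneg (|f.1 x - f.1 y| - 1), abs_nonneg (f.1 x - f.1 y)]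
  calc _ ≤ (G.b x y : ℝ) * (1 + (f.1 x - f.1 y) ^ 2) := mul_le_mul_of_nonneg_left h3 hb
    _ = _ := by ring

/-- Green's formula for a point mass. -/
theorem inner_gradientLp_single (G : WeightedGraph X) (f : G.energySubmodule) (x : X) :
    inner ℝ (G.gradientLp (G.finsuppIncl (Finsupp.single x 1))) (G.gradientLp f) =
      G.laplacian f x := by
  classical
  set S := ∑' y, (G.b x y : ℝ) * (f.1 x - f.1 y) with hS
  have hsum : HasSum (fun y => (G.b x y : ℝ) * (f.1 x - f.1 y) / 2) (S / 2) :=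
    (G.summable_b_mul_sub f x).hasSum.div_const 2
  -- The gradient of a point mass lives on the pairs with first entry `x`, those with second entry
  -- `x`, and the killing coordinate at `x`. The two families of pairs give half of the edge sum
  -- each; their common pair `(x, x)` contributes zero.
  have h1 : HasSum (Sum.elim (fun q : X × X => if q.1 = x then
      (G.b x q.2 : ℝ) * (f.1 x - f.1 q.2) / 2 else 0) (fun _ : X => 0)) (S / 2) := by
    have hinj : Function.Injective fun y => (Sum.inl (x, y) : (X × X) ⊕ X) := by
      intro y z hyz
      simpa using hyz
    refine (hinj.hasSum_iff ?_).1 ?_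
    · rintro (⟨u, v⟩ | y) h
      · simp only [Sum.elim_inl, ite_eq_right_iff]
        rintro rfl
        exact absurd ⟨v, rfl⟩ h
      · rfl
    · simpa [Function.comp_def] using hsum
  have h2 : HasSum (Sum.elim (fun q : X × X => if q.2 = x then
      (G.b x q.1 : ℝ) * (f.1 x - f.1 q.1) / 2 else 0) (fun _ : X => 0)) (S / 2) := by
    have hinj : Function.Injective fun y => (Sum.inl (y, x) : (X × X) ⊕ X) := by
      intro y z hyz
      simpa using hyz
    refine (hinj.hasSum_iff ?_).1 ?_
    · rintro (⟨u, v⟩ | y) h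
      · simp only [Sum.elim_inl, ite_eq_right_iff]
        rintro rfl
        exact absurd ⟨u, rfl⟩ h
      · rfl
    · simpa [Function.comp_def] using hsum
  have h3 : HasSum (Sum.elim (fun _ : X × X => 0) (fun y : X => if y = x then
      (G.c x : ℝ) * f.1 x else 0)) ((G.c x : ℝ) * f.1 x) := by
    have h := hasSum_single (f := (Sum.elim (fun _ : X × X => 0) (fun y : X => if y = x then
      (G.c x : ℝ) * f.1 x else 0))) (Sum.inr x) (by
        rintro (⟨u, v⟩ | y) h
        · rfl
        · have : y ≠ x := fun e => h (by rw [e])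
          simp [this])
    simpa using h
  have h := (h1.add h2).add h3
  have h' := lp.hasSum_inner (𝕜 := ℝ) (G.gradientLp (G.finsuppIncl (Finsupp.single x 1)))
    (G.gradientLp f)
  rw [laplacian, ← hS]
  refine (h'.unique (?_ : HasSum _ (S / 2 + S / 2 + G.c x * f.1 x))).trans (by ring)
  convert h using 1
  ext (⟨u, v⟩ | y)
  · have hb := Real.mul_self_sqrt (show (0 : ℝ) ≤ G.b u v / 2 by positivity)
    simp only [gradientLp_apply, gradient_inl, Real.inner_apply, Sum.elim_inl, coe_finsuppIncl,
      Finsupp.single_apply, add_zero]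
    by_cases hu : u = x <;> by_cases hv : v = x
    · simp [hu, hv]
    · subst hu
      simp only [hv, Ne.symm hv, if_true, if_false]
      linear_combination (f.1 u - f.1 v) * hb
    · subst hv
      simp only [hu, Ne.symm hu, if_true, if_false]
      rw [G.symm v u]
      linear_combination (f.1 v - f.1 u) * hb
    · simp [hu, hv, Ne.symm hu, Ne.symm hv]
  · have hc := Real.mul_self_sqrt (show (0 : ℝ) ≤ G.c y by positivity)
    simp only [gradientLp_apply, gradient_inr, Real.inner_apply, Sum.elim_inr, coe_finsuppIncl,
      Finsupp.single_apply, add_zero, zero_add]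
    by_cases hy : y = x
    · subst hy
      simp only [if_true]
      linear_combination f.1 y * hc
    · simp [hy, Ne.symm hy]

end Laplacian

end WeightedGraph

namespace WeightedGraph

variable {X : Type*}

/-! ### Royden decomposition by orthogonal projection -/

section Decomposition

open Filter Topology

theorem tendsto_lp_apply {I : Type*} {u : ℕ → lp (fun _ : I => ℝ) 2}
    {w : lp (fun _ : I => ℝ) 2} (h : Tendsto u atTop (𝓝 w)) (i : I) :
    Tendsto (fun n => u n i) atTop (𝓝 (w i)) :=
  ((continuous_apply i).comp lp.uniformContinuous_coe.continuous).continuousAt.tendsto.comp h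

/-- Convergence of the gradients and convergence at one vertex imply pointwise convergence. -/
theorem IsConnected.exists_tendsto {G : WeightedGraph X} (hconn : G.IsConnected) {o : X}
    {u : ℕ → G.energySubmodule} {w : lp (fun _ : (X × X) ⊕ X => ℝ) 2}
    (hw : Tendsto (fun n => G.gradientLp (u n)) atTop (𝓝 w)) {a : ℝ}
    (ho : Tendsto (fun n => (u n).1 o) atTop (𝓝 a)) (x : X) :
    ∃ l, Tendsto (fun n => (u n).1 x) atTop (𝓝 l) := by
  have hreach := (SimpleGraph.reachable_iff_reflTransGen o x).1 (hconn.preconnected o x)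
  induction hreach with
  | refl => exact ⟨a, ho⟩
  | @tail y z _ hyz ih =>
    obtain ⟨l, hl⟩ := ih
    have hb : (0 : ℝ) < G.b y z := hyz
    have hs : √(G.b y z / 2 : ℝ) ≠ 0 := by positivity
    -- A gradient coordinate divided by its nonzero weight is the increment across the edge, so
    -- convergence passes from `y` to `z`.
    have h1 := (tendsto_lp_apply hw (Sum.inl (y, z))).div_const √(G.b y z / 2 : ℝ)
    refine ⟨_, (hl.sub h1).congr fun n => ?_⟩
    rw [gradientLp_apply, gradient_inl, mul_div_cancel_left₀ _ hs]
    ring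

/-- Pointwise limits realize limits of gradients. -/
theorem gradientLp_eq_of_tendsto {G : WeightedGraph X} {u : ℕ → G.energySubmodule}
    {w : lp (fun _ : (X × X) ⊕ X => ℝ) 2}
    (hw : Tendsto (fun n => G.gradientLp (u n)) atTop (𝓝 w)) {f : X → ℝ}
    (hf : ∀ x, Tendsto (fun n => (u n).1 x) atTop (𝓝 (f x))) :
    ∃ hf' : f ∈ G.energySubmodule, G.gradientLp ⟨f, hf'⟩ = w := by
  have h : G.gradient f = w := by
    ext i
    refine tendsto_nhds_unique ?_ (tendsto_lp_apply hw i)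
    rcases i with ⟨x, y⟩ | x
    · exact ((hf x).sub (hf y)).const_mul _
    · exact (hf x).const_mul _
  have hf' : f ∈ G.energySubmodule := by
    refine G.memℓp_gradient_iff.1 ?_
    rw [h]
    exact lp.memℓp w
  exact ⟨hf', Subtype.ext h⟩

theorem one_notMem_vanishingAtInfinity [Infinite X] :
    (fun _ : X => (1 : ℝ)) ∉ vanishingAtInfinity X := by
  intro h
  obtain ⟨φ, hφ, h1⟩ := h (1 / 2) (by norm_num)
  obtain ⟨x, hx⟩ := hφ.infinite_compl.nonempty
  have h2 : φ x = 0 := by simpa using hx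
  have h3 := h1 x
  rw [h2] at h3
  norm_num at h3

/-- On a uniformly transient graph the value of a finitely supported function at a vertex is
controlled by its energy. -/
theorem UniformlyTransient.exists_bound [Infinite X] {G : WeightedGraph X} {o : X}
    (hut : G.UniformlyTransient o) (hconn : G.IsConnected) :
    ∃ C : ℝ, ∀ φ : X →₀ ℝ, |φ o| ≤ C * ‖G.gradientLp (G.finsuppIncl φ)‖ := by
  by_contra! hcon
  -- Failure of the bound for the constants `n + 1` gives, after normalizing the value at `o` to 1,
  -- gradients tending to zero. The pointwise limit has zero gradient, so it is the constant 1, and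
  -- it lies in `D₀`.
  choose v hv using fun n : ℕ => hcon (n + 1)
  have hpos : ∀ n, 0 < |v n o| := fun n => lt_of_le_of_lt (by positivity) (hv n)
  have hne : ∀ n, v n o ≠ 0 := fun n => abs_pos.1 (hpos n)
  let u : ℕ → X →₀ ℝ := fun n => (v n o)⁻¹ • v n
  have huo : ∀ n, u n o = 1 := fun n => by simp [u, hne n]
  have hu : ∀ n, ‖G.gradientLp (G.finsuppIncl (u n))‖ ≤ 1 / ((n : ℝ) + 1) := fun n => by
    have := hv n
    simp only [u, map_smul, norm_smul, norm_inv, Real.norm_eq_abs]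
    rw [inv_mul_eq_div, div_le_div_iff₀ (hpos n) (by positivity)]
    linarith
  have hw : Tendsto (fun n => G.gradientLp (G.finsuppIncl (u n))) atTop (𝓝 0) :=
    squeeze_zero_norm hu tendsto_one_div_add_atTop_nhds_zero_nat
  have ho : Tendsto (fun n => (G.finsuppIncl (u n)).1 o) atTop (𝓝 1) := by simp [huo]
  choose f hf using fun x => hconn.exists_tendsto hw ho x
  obtain ⟨hf', hgrad⟩ := gradientLp_eq_of_tendsto hw hf
  have hadj : ∀ x y, G.toSimpleGraph.Adj x y → f x = f y := fun x y hxy => by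
    have hb : (0 : ℝ) < G.b x y := hxy
    have hs : √(G.b x y / 2 : ℝ) ≠ 0 := by positivity
    have h := congrArg (fun w : lp (fun _ : (X × X) ⊕ X => ℝ) 2 => w (Sum.inl (x, y))) hgrad
    simp only [gradientLp_apply, gradient_inl, lp.coeFn_zero, Pi.zero_apply] at h
    exact sub_eq_zero.1 ((mul_eq_zero.1 h).resolve_left hs)
  have hconst : f = fun _ => 1 := by
    funext x
    have hreach := (SimpleGraph.reachable_iff_reflTransGen o x).1 (hconn.preconnected o x)
    induction hreach with
    | refl => exact tendsto_nhds_unique (hf o) ho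
    | tail _ hyz ih => rw [← hadj _ _ hyz, ih]
  have hmem : f ∈ G.finiteEnergyZero o :=
    G.mem_finiteEnergyZero_of_tendsto o ⟨f, hf'⟩ u (by rwa [hgrad]) (hf o)
  exact one_notMem_vanishingAtInfinity (hconst ▸ hut hmem)

/-- Limits of gradients of finitely supported functions are gradients of functions in `D₀`. -/
theorem UniformlyTransient.exists_gradientLp_eq [Infinite X] {G : WeightedGraph X} {o : X}
    (hut : G.UniformlyTransient o) (hconn : G.IsConnected)
    {w : lp (fun _ : (X × X) ⊕ X => ℝ) 2}
    (hw : w ∈ closure (Set.range fun φ => G.gradientLp (G.finsuppIncl φ))) :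
    ∃ f : G.energySubmodule, f.1 ∈ G.finiteEnergyZero o ∧ G.gradientLp f = w := by
  obtain ⟨C, hC⟩ := hut.exists_bound hconn
  obtain ⟨s, hs, hsw⟩ := mem_closure_iff_seq_limit.1 hw
  choose u hu using hs
  have hw : Tendsto (fun n => G.gradientLp (G.finsuppIncl (u n))) atTop (𝓝 w) := by
    simpa only [hu] using hsw
  have hcau : CauchySeq fun n => u n o := by
    have hC0 : ∀ m n, dist (u m o) (u n o) ≤
        |C| * dist (G.gradientLp (G.finsuppIncl (u m))) (G.gradientLp (G.finsuppIncl (u n))) := by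
      intro m n
      rw [Real.dist_eq, dist_eq_norm, ← map_sub, ← map_sub, ← Finsupp.sub_apply]
      exact (hC _).trans (mul_le_mul_of_nonneg_right (le_abs_self C) (norm_nonneg _))
    rw [Metric.cauchySeq_iff]
    intro ε hε
    -- The constant `C` may vanish; `|C| + 1` is a positive divisor.
    obtain ⟨N, hN⟩ := Metric.cauchySeq_iff.1 hw.cauchySeq (ε / (|C| + 1)) (by positivity)
    refine ⟨N, fun m hm n hn => (hC0 m n).trans_lt ?_⟩
    have h := (lt_div_iff₀ (by positivity)).1 (hN m hm n hn)
    refine lt_of_le_of_lt ?_ h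
    rw [mul_comm]
    exact mul_le_mul_of_nonneg_left (by linarith) dist_nonneg
  obtain ⟨a, ha⟩ := cauchySeq_tendsto_of_complete hcau
  choose f hf using fun x => hconn.exists_tendsto hw ha x
  obtain ⟨hf', hgrad⟩ := gradientLp_eq_of_tendsto hw hf
  exact ⟨⟨f, hf'⟩, G.mem_finiteEnergyZero_of_tendsto o ⟨f, hf'⟩ u (by rwa [hgrad]) (hf o), hgrad⟩

/-- The Royden decomposition. -/
theorem UniformlyTransient.exists_decomposition [Infinite X] {G : WeightedGraph X} {o : X}
    (hut : G.UniformlyTransient o) (hconn : G.IsConnected) (g : G.energySubmodule) :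
    ∃ f : G.energySubmodule, f.1 ∈ G.finiteEnergyZero o ∧
      ∀ x, G.laplacian (g - f : G.energySubmodule) x = 0 := by
  let K : Submodule ℝ (lp (fun _ : (X × X) ⊕ X => ℝ) 2) :=
    (LinearMap.range (G.gradientLp ∘ₗ G.finsuppIncl)).topologicalClosure
  have hK : IsComplete (K : Set (lp (fun _ : (X × X) ⊕ X => ℝ) 2)) :=
    (Submodule.isClosed_topologicalClosure _).isComplete
  have : CompleteSpace K := completeSpace_coe_iff_isComplete.2 hK
  have hmem : K.starProjection (G.gradientLp g) ∈ K := K.starProjection_apply_mem _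
  obtain ⟨f, hf, hgrad⟩ := hut.exists_gradientLp_eq hconn
    (w := K.starProjection (G.gradientLp g)) hmem
  refine ⟨f, hf, fun x => ?_⟩
  -- The residual of the projection is orthogonal to the gradient of every point mass.
  rw [← inner_gradientLp_single, map_sub, hgrad]
  refine (K.mem_orthogonal _).1 (K.sub_starProjection_mem_orthogonal _) _ ?_
  exact subset_closure ⟨Finsupp.single x 1, rfl⟩

end Decomposition

/-! ### Bounded harmonic functions -/

section BoundedFunctions

theorem summable_b_mul_of_bounded (G : WeightedGraph X) {f : X → ℝ} {C : ℝ}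
    (hC : ∀ x, |f x| ≤ C) (x : X) : Summable fun y => (G.b x y : ℝ) * |f y| := by
  refine ((G.summable_b_real x).mul_right C).of_nonneg_of_le (fun y => by positivity) fun y => ?_
  exact mul_le_mul_of_nonneg_left (hC y) (NNReal.coe_nonneg _)

theorem summable_b_mul_sub_of_mem_domain {G : WeightedGraph X} {f : X → ℝ}
    (hf : f ∈ G.laplacianDomain) (x : X) :
    Summable fun y => (G.b x y : ℝ) * (f x - f y) := by
  have h : Summable fun y => (G.b x y : ℝ) * f y :=
    (hf x).of_norm_bounded fun y => by simp
  exact (((G.summable_b_real x).mul_right (f x)).sub h).congr fun y => by ring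

theorem laplacian_sub {G : WeightedGraph X} {f g : X → ℝ}
    (hf : f ∈ G.laplacianDomain) (hg : g ∈ G.laplacianDomain) (x : X) :
    G.laplacian (f - g) x = G.laplacian f x - G.laplacian g x := by
  have h := (summable_b_mul_sub_of_mem_domain hf x).tsum_sub
    (summable_b_mul_sub_of_mem_domain hg x)
  have h' : ∀ y, (G.b x y : ℝ) * ((f - g) x - (f - g) y) =
      G.b x y * (f x - f y) - G.b x y * (g x - g y) := fun y => by
    simp only [Pi.sub_apply]; ring
  rw [laplacian, laplacian, laplacian, tsum_congr h', h, Pi.sub_apply]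
  ring

theorem IsHarmonic.sub {G : WeightedGraph X} {f g : X → ℝ}
    (hf : G.IsHarmonic f) (hg : G.IsHarmonic g) : G.IsHarmonic (f - g) := by
  refine ⟨fun x => ?_, fun x => by rw [laplacian_sub hf.1 hg.1, hf.2, hg.2, sub_zero]⟩
  refine ((hf.1 x).add (hg.1 x)).of_nonneg_of_le (fun y => by positivity) fun y => ?_
  rw [← mul_add]
  exact mul_le_mul_of_nonneg_left (abs_sub _ _) (NNReal.coe_nonneg _)

theorem lp_mem_laplacianDomain (G : WeightedGraph X) (f : lp (fun _ : X => ℝ) ∞) :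
    ⇑f ∈ G.laplacianDomain :=
  G.summable_b_mul_of_bounded (lp.norm_apply_le_norm ENNReal.top_ne_zero f)

/-- At each fixed vertex the Laplacian is continuous for the supremum norm, so harmonicity survives
uniform limits even when finite energy is lost. -/
theorem abs_laplacian_le (G : WeightedGraph X) (f : lp (fun _ : X => ℝ) ∞) (x : X) :
    |G.laplacian f x| ≤ (2 * (∑' y, (G.b x y : ℝ)) + G.c x) * ‖f‖ := by
  have hf : ∀ y, |f y| ≤ ‖f‖ := lp.norm_apply_le_norm ENNReal.top_ne_zero f
  have hb := (G.summable_b_real x).mul_right (2 * ‖f‖)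
  have h1 : ‖∑' y, (G.b x y : ℝ) * (f x - f y)‖ ≤ ∑' y, (G.b x y : ℝ) * (2 * ‖f‖) := by
    refine tsum_of_norm_bounded hb.hasSum fun y => ?_
    rw [norm_mul, Real.norm_eq_abs, Real.norm_eq_abs, NNReal.abs_eq]
    refine mul_le_mul_of_nonneg_left ?_ (NNReal.coe_nonneg _)
    linarith [abs_sub (f x) (f y), hf x, hf y]
  have h2 : |(G.c x : ℝ) * f x| ≤ G.c x * ‖f‖ := by
    rw [abs_mul, NNReal.abs_eq]
    exact mul_le_mul_of_nonneg_left (hf x) (NNReal.coe_nonneg _)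
  rw [tsum_mul_right, Real.norm_eq_abs] at h1
  rw [laplacian]
  linarith [abs_add_le (∑' y, (G.b x y : ℝ) * (f x - f y)) ((G.c x : ℝ) * f x)]

theorem isClosed_isHarmonic (G : WeightedGraph X) :
    IsClosed {f : lp (fun _ : X => ℝ) ∞ | G.IsHarmonic f} := by
  refine IsSeqClosed.isClosed fun u f hu huf => ⟨G.lp_mem_laplacianDomain f, fun x => ?_⟩
  have h : ∀ n, |G.laplacian f x| ≤ (2 * (∑' y, (G.b x y : ℝ)) + G.c x) * ‖f - u n‖ := fun n => by
    have h1 := laplacian_sub (G.lp_mem_laplacianDomain f) (G.lp_mem_laplacianDomain (u n)) x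
    rw [(hu n).2 x, sub_zero] at h1
    rw [← h1]
    exact G.abs_laplacian_le (f - u n) x
  have h2 := ((tendsto_const_nhds (x := f)).sub huf).norm.const_mul
    (2 * (∑' y, (G.b x y : ℝ)) + G.c x)
  rw [sub_self, norm_zero, mul_zero] at h2
  exact abs_nonpos_iff.1 (ge_of_tendsto' h2 h)

/-- A harmonic function that attains a nonnegative maximum is constant. -/
theorem IsHarmonic.eq_of_forall_le {G : WeightedGraph X} (hconn : G.IsConnected) {f : X → ℝ}
    (hf : G.IsHarmonic f) {o : X} (h0 : 0 ≤ f o) (hmax : ∀ x, f x ≤ f o) (x : X) :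
    f x = f o := by
  have hreach := (SimpleGraph.reachable_iff_reflTransGen o x).1 (hconn.preconnected o x)
  induction hreach with
  | refl => rfl
  | @tail y z _ hyz ih =>
    have hb : (0 : ℝ) < G.b y z := hyz
    have hsum := summable_b_mul_sub_of_mem_domain hf.1 y
    -- At a nonnegative maximum every edge term and the killing term are nonnegative; as they sum to
    -- zero, each vanishes.
    have hnn : ∀ w, 0 ≤ (G.b y w : ℝ) * (f y - f w) := fun w =>
      mul_nonneg (NNReal.coe_nonneg _) (by rw [ih]; linarith [hmax w])
    have h1 := hsum.le_tsum z fun w _ => hnn w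
    have h2 : (0 : ℝ) ≤ G.c y * f y := mul_nonneg (NNReal.coe_nonneg _) (by rw [ih]; exact h0)
    have h3 := hf.2 y
    rw [laplacian] at h3
    have h4 : (G.b y z : ℝ) * (f y - f z) = 0 := le_antisymm (by linarith) (hnn z)
    have h5 := (mul_eq_zero.1 h4).resolve_left hb.ne'
    linarith

end BoundedFunctions

end WeightedGraph

namespace WeightedGraph

variable {X : Type*}

open Filter Topology

/-! ### Membership in the Royden algebra -/

section RoydenAlgebra

/-- Under uniform transience this makes the `D₀` part of the decomposition bounded. -/
theorem vanishingAtInfinity.memℓp {f : X → ℝ} (hf : f ∈ vanishingAtInfinity X) : Memℓp f ∞ := by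
  obtain ⟨φ, hφ, h⟩ := hf 1 one_pos
  obtain ⟨C, hC⟩ := (hφ.image fun x => |φ x|).bddAbove
  refine memℓp_infty ⟨1 + max C 0, ?_⟩
  rintro _ ⟨x, rfl⟩
  have h1 : |φ x| ≤ max C 0 := by
    by_cases hx : φ x = 0
    · simp [hx]
    · exact (hC ⟨x, hx, rfl⟩).trans (le_max_left _ _)
  have h2 := abs_add_le (f x - φ x) (φ x)
  rw [sub_add_cancel] at h2
  exact h2.trans (add_le_add (h x) h1)

theorem roydenAlgebra_sub_mem {G : WeightedGraph X} {f g : lp (fun _ : X => ℝ) ∞}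
    (hf : f ∈ G.roydenAlgebra) (hg : g ∈ G.roydenAlgebra) : f - g ∈ G.roydenAlgebra :=
  map_mem_closure₂ continuous_sub hf hg fun _ ha _ hb => G.energySubmodule.sub_mem ha hb

end RoydenAlgebra

/-! ### Ideal points, maximum principle, Dirichlet problem -/

namespace IsRoydenCompactification

variable {G : WeightedGraph X} {R : Type*} [TopologicalSpace R] {ι : X → R}

theorem abs_hat_le (hR : G.IsRoydenCompactification ι) (f : G.roydenAlgebra) (p : R) :
    |hR.hat f p| ≤ ‖f.1‖ := by
  refine hR.dense.induction_on (p := fun p => |hR.hat f p| ≤ ‖f.1‖) p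
    (isClosed_le (by fun_prop) continuous_const) fun x => ?_
  rw [hR.hat_apply]
  exact lp.norm_apply_le_norm ENNReal.top_ne_zero f.1 x

theorem hat_sub (hR : G.IsRoydenCompactification ι) (f g : G.roydenAlgebra) (p : R) :
    hR.hat ⟨f.1 - g.1, roydenAlgebra_sub_mem f.2 g.2⟩ p = hR.hat f p - hR.hat g p := by
  refine hR.dense.induction_on (p := fun p =>
    hR.hat ⟨f.1 - g.1, roydenAlgebra_sub_mem f.2 g.2⟩ p = hR.hat f p - hR.hat g p) p
    (isClosed_eq (by fun_prop) (by fun_prop)) fun x => ?_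
  simp only [hR.hat_apply]
  rfl

theorem abs_hat_sub_le (hR : G.IsRoydenCompactification ι) (f g : G.roydenAlgebra) (p : R) :
    |hR.hat f p - hR.hat g p| ≤ dist f g := by
  rw [← hat_sub, Subtype.dist_eq, dist_eq_norm]
  exact hR.abs_hat_le _ p

/-- On a uniformly transient graph every ideal point belongs to the harmonic boundary. -/
theorem mem_harmonicBoundary_of_notMem_range (hR : G.IsRoydenCompactification ι) {o : X}
    (hut : G.UniformlyTransient o) {p : R} (hp : p ∉ Set.range ι) :
    p ∈ hR.harmonicBoundary o := by
  intro f hf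
  have := hR.hausdorff
  set F := hR.hat ⟨f, subset_closure hf.1⟩ with hF
  refine abs_nonpos_iff.1 (le_of_forall_pos_le_add fun ε hε => ?_)
  rw [zero_add]
  obtain ⟨φ, hφ, h⟩ := hut hf ε hε
  -- An ideal point avoids the finite closed set carrying `φ`, so it is a limit of vertices off the
  -- support, where `|f| ≤ ε`.
  have hU : IsOpen (ι '' φ.support)ᶜ := (hφ.image ι).isClosed.isOpen_compl
  have hpU : p ∈ (ι '' φ.support)ᶜ := fun ⟨x, _, hx⟩ => hp ⟨x, hx⟩
  have h1 := hR.dense.open_subset_closure_inter hU hpU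
  have h2 : IsClosed {q | |F q| ≤ ε} := isClosed_le (by fun_prop) continuous_const
  refine closure_minimal ?_ h2 h1
  rintro _ ⟨hx, ⟨x, rfl⟩⟩
  have h3 : φ x = 0 := by
    by_contra h3
    exact hx ⟨x, h3, rfl⟩
  have h4 := h x
  rw [h3, sub_zero] at h4
  change |F (ι x)| ≤ ε
  rwa [hF, hR.hat_apply]

/-- The infinite image of `X` accumulates somewhere in the compact space `R`, but not at a vertex
`z`: the extension of the point mass at `z` separates it from all other vertices. -/
theorem exists_notMem_range [Infinite X] (hR : G.IsRoydenCompactification ι) :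
    ∃ p, p ∉ Set.range ι := by
  classical
  have := hR.compact
  obtain ⟨p, hp⟩ := (Set.infinite_range_of_injective hR.injective).exists_accPt_principal
  refine ⟨p, ?_⟩
  rintro ⟨z, rfl⟩
  have hmem : Memℓp (Pi.single z (1 : ℝ) : X → ℝ) ∞ := memℓp_infty ⟨1, by
    rintro _ ⟨x, rfl⟩
    by_cases h : x = z <;> simp [h]⟩
  obtain ⟨F, hF, -⟩ := hR.extends_uniquely ⟨_, hmem⟩ (G.energy_single_lt_top z)
  have hU : {q | (1 / 2 : ℝ) < F q} ∈ 𝓝 (ι z) :=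
    (isOpen_lt continuous_const F.continuous).mem_nhds (by simp [hF]; norm_num)
  obtain ⟨_, ⟨hq, ⟨x, rfl⟩⟩, hne⟩ := accPt_iff_nhds.1 hp _ hU
  have hxz : x ≠ z := fun h => hne (by rw [h])
  have h1 : F (ι x) = 0 := by rw [hF]; simp [hxz]
  have h2 : (1 / 2 : ℝ) < F (ι x) := hq
  rw [h1] at h2
  norm_num at h2

/-- The maximum principle. -/
theorem le_of_forall_harmonicBoundary_le [Infinite X] (hR : G.IsRoydenCompactification ι) {o : X}
    (hconn : G.IsConnected) (hut : G.UniformlyTransient o) {f : G.roydenAlgebra}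
    (hf : G.IsHarmonic f.1) {C : ℝ} (hC0 : 0 ≤ C)
    (hC : ∀ p ∈ hR.harmonicBoundary o, hR.hat f p ≤ C) (x : X) : f.1 x ≤ C := by
  have := hR.compact
  have : Nonempty R := ⟨ι o⟩
  obtain ⟨p, hp⟩ := (hR.hat f).continuous.exists_forall_ge_of_hasCompactSupport
    (HasCompactSupport.of_compactSpace _)
  rw [← hR.hat_apply]
  refine (hp _).trans ?_
  by_cases hpr : p ∈ Set.range ι
  · obtain ⟨z, rfl⟩ := hpr
    -- A value above `C` is positive, so the maximum at `z` makes `f` constant, and its extension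
    -- exceeds `C` at an ideal point too. With killing, `0 ≤ C` is essential here.
    by_contra! hz
    rw [hR.hat_apply] at hz
    have hconst := hf.eq_of_forall_le hconn (hC0.trans hz.le) fun y => by
      rw [← hR.hat_apply, ← hR.hat_apply]; exact hp _
    obtain ⟨q, hq⟩ := hR.exists_notMem_range
    have h1 : hR.hat f q = f.1 z :=
      hR.dense.induction_on (p := fun q => hR.hat f q = f.1 z) q
        (isClosed_eq (by fun_prop) continuous_const) fun y => by rw [hR.hat_apply, hconst]
    have h2 := hC q (hR.mem_harmonicBoundary_of_notMem_range hut hq)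
    linarith
  · exact hC p (hR.mem_harmonicBoundary_of_notMem_range hut hpr)

/-- One inequality is the maximum principle for `f - g` and `g - f` with the bound `dist φ ψ`; the
other holds because extensions do not increase the supremum norm. -/
theorem SolvesDirichlet.dist_eq [Infinite X] {hR : G.IsRoydenCompactification ι} {o : X}
    (hconn : G.IsConnected) (hut : G.UniformlyTransient o)
    {φ ψ : hR.harmonicBoundary o →ᵇ ℝ} {f g : G.roydenAlgebra}
    (hf : hR.SolvesDirichlet o φ f) (hg : hR.SolvesDirichlet o ψ g) : dist f g = dist φ ψ := by
  apply le_antisymm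
  · have key : ∀ {φ ψ : hR.harmonicBoundary o →ᵇ ℝ} {f g : G.roydenAlgebra},
        hR.SolvesDirichlet o φ f → hR.SolvesDirichlet o ψ g →
          ∀ x, f.1 x - g.1 x ≤ dist φ ψ := by
      intro φ ψ f g hf hg
      refine hR.le_of_forall_harmonicBoundary_le hconn hut
        (f := ⟨f.1 - g.1, roydenAlgebra_sub_mem f.2 g.2⟩) (hf.1.sub hg.1) dist_nonneg
        fun p hp => ?_
      rw [hat_sub, hf.2 ⟨p, hp⟩, hg.2 ⟨p, hp⟩]
      exact (le_abs_self _).trans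
        ((Real.dist_eq _ _).symm.le.trans (BoundedContinuousFunction.dist_coe_le_dist _))
    rw [Subtype.dist_eq, dist_eq_norm]
    refine lp.norm_le_of_forall_le dist_nonneg fun x => abs_le'.2 ⟨key hf hg x, ?_⟩
    have h := key hg hf x
    rw [dist_comm] at h
    refine le_trans (le_of_eq ?_) h
    exact neg_sub (f.1 x) (g.1 x)
  · refine (BoundedContinuousFunction.dist_le dist_nonneg).2 fun p => ?_
    rw [← hf.2 p, ← hg.2 p]
    exact hR.abs_hat_sub_le f g p

/-- Subtracting the `D₀` part does not change the trace, by the very definition of the harmonic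
boundary. -/
theorem exists_solvesDirichlet_of_finiteEnergy [Infinite X] (hR : G.IsRoydenCompactification ι)
    {o : X} (hconn : G.IsConnected) (hut : G.UniformlyTransient o) (g : G.roydenAlgebra)
    (hg : g.1 ∈ G.boundedFiniteEnergy) : ∃ f, hR.SolvesDirichlet o (hR.trace o g) f := by
  obtain ⟨f₀, hf₀, hharm⟩ := hut.exists_decomposition hconn ⟨g.1, hg⟩
  let F₀ : lp (fun _ : X => ℝ) ∞ := ⟨f₀.1, vanishingAtInfinity.memℓp (hut hf₀)⟩
  let F : G.roydenAlgebra := ⟨F₀, subset_closure f₀.2⟩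
  refine ⟨⟨g.1 - F.1, roydenAlgebra_sub_mem g.2 F.2⟩,
    ⟨G.lp_mem_laplacianDomain _, hharm⟩, fun p => ?_⟩
  have h : hR.hat F p = 0 := p.2 F₀ hf₀
  rw [hat_sub, h, sub_zero]
  rfl

theorem dist_trace_le (hR : G.IsRoydenCompactification ι) (o : X) (f g : G.roydenAlgebra) :
    dist (hR.trace o f) (hR.trace o g) ≤ dist f g :=
  (BoundedContinuousFunction.dist_le dist_nonneg).2 fun p => hR.abs_hat_sub_le f g p

/-- Solutions for finite-energy approximants of `g` are as close as their traces, hence form a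
Cauchy sequence; both harmonicity and boundary values pass to its limit. -/
theorem exists_solvesDirichlet [Infinite X] (hR : G.IsRoydenCompactification ι)
    {o : X} (hconn : G.IsConnected) (hut : G.UniformlyTransient o) (g : G.roydenAlgebra) :
    ∃ f, hR.SolvesDirichlet o (hR.trace o g) f := by
  obtain ⟨u, hu, hug⟩ := mem_closure_iff_seq_limit.1 g.2
  let v : ℕ → G.roydenAlgebra := fun n => ⟨u n, subset_closure (hu n)⟩
  have hv : Tendsto v atTop (𝓝 g) := tendsto_subtype_rng.2 hug
  choose w hw using fun n => hR.exists_solvesDirichlet_of_finiteEnergy hconn hut (v n) (hu n)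
  have hcau : CauchySeq w := by
    rw [Metric.cauchySeq_iff]
    intro ε hε
    obtain ⟨N, hN⟩ := Metric.cauchySeq_iff.1 hv.cauchySeq ε hε
    refine ⟨N, fun m hm n hn => lt_of_le_of_lt ?_ (hN m hm n hn)⟩
    rw [(hw m).dist_eq hconn hut (hw n)]
    exact hR.dist_trace_le o _ _
  have : CompleteSpace G.roydenAlgebra := isClosed_closure.completeSpace_coe
  obtain ⟨f, hf⟩ := cauchySeq_tendsto_of_complete hcau
  have hhat : ∀ {s : ℕ → G.roydenAlgebra} {l : G.roydenAlgebra}, Tendsto s atTop (𝓝 l) →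
      ∀ p, Tendsto (fun n => hR.hat (s n) p) atTop (𝓝 (hR.hat l p)) := by
    intro s l hs p
    refine tendsto_iff_dist_tendsto_zero.2 (squeeze_zero (fun _ => dist_nonneg) (fun n => ?_)
      (tendsto_iff_dist_tendsto_zero.1 hs))
    exact hR.abs_hat_sub_le _ _ p
  refine ⟨f, ?_, fun p => ?_⟩
  · exact G.isClosed_isHarmonic.mem_of_tendsto (tendsto_subtype_rng.1 hf)
      (Eventually.of_forall fun n => (hw n).1)
  · exact tendsto_nhds_unique (hhat hf p) ((hhat hv p).congr fun n => ((hw n).2 p).symm)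

end IsRoydenCompactification

end WeightedGraph

theorem theorem4p8 {X : Type*} [Countable X] [Infinite X] (G : WeightedGraph X) (o : X)
    (hconn : G.IsConnected) (hut : G.UniformlyTransient o)
    {R : Type*} [TopologicalSpace R] {ι : X → R} (hR : G.IsRoydenCompactification ι) :
    (∀ φ ∈ hR.boundaryFunctions o, ∃! f : G.roydenAlgebra, hR.SolvesDirichlet o φ f) ∧
    ∀ S : hR.boundaryFunctions o → G.roydenAlgebra,
      (∀ φ, hR.SolvesDirichlet o φ.1 (S φ)) → Isometry S := by
  refine ⟨?_, fun S hS => Isometry.of_dist_eq fun φ ψ => (hS φ).dist_eq hconn hut (hS ψ)⟩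
  rintro _ ⟨g, rfl⟩
  obtain ⟨f, hf⟩ := hR.exists_solvesDirichlet hconn hut g
  -- Uniqueness is the distance identity for equal boundary values.
  exact ⟨f, hf, fun f' hf' => dist_eq_zero.1 (by rw [hf'.dist_eq hconn hut hf, dist_self])⟩
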